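/- Let $n\ge 1$. Regard $\pi\in S_n$ as the arrangement $\pi(1),\dots,\pi(n)$ of the numbers $1,\dots,n$ in positions $1,\dots,n$. A placement chooses a number $i$ that is not in position $i$, removes it, and reinserts it in position $i$, the numbers between its old position and position $i$ (inclusive of position $i$) being shifted by one position to make room. Then $2^{n-1}-1$ is the maximum length of a sequence of placements that starts at some permutation in $S_n$ and ends at the identity. Let $M_n$ be the set of all $\pi\in S_n$ for which the maximum length of a sequence of placements from $\pi$ to the identity equals $2^{n-1}-1$. Then $$|M_n|\ \ge\ B_{n-1},$$ where $B_m$, the $m$th Bell number, is the number of partitions of the set $\{1,\dots,m\}$ (so $B_0=1$). In particular $|M_n|$ grows super-exponentially: for every real $C>0$, $|M_n|/C^n\to\infty$ as $n\to\infty$. -/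

import Mathlib

/-- One placement step of homing, on arrangements `π` of the numbers `0, …, n-1` in positions
`0, …, n-1`; `π p` is the number in position `p` and `π.symm j` is the position of the number `j`.
The number `i`, which is not at home in `π`, is put in its proper position, giving `π'`.
If `i` was to the right of its proper position, the numbers standing in positions from `i` up to
just before the old position of `i` are shifted one position to the right; if it was to the left,
the numbers standing in positions from just after the old position of `i` up to `i` are shifted one
position to the left; all other numbers stay where they are. -/
def IsPlacement {n : ℕ} (i : Fin n) (π π' : Equiv.Perm (Fin n)) : Prop :=
  π i ≠ i ∧ π' i = i ∧
    ∀ j : Fin n, j ≠ i →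
      ((π'.symm j : Fin n) : ℕ) =
        if i ≤ π.symm j ∧ π.symm j < π.symm i then ((π.symm j : Fin n) : ℕ) + 1
        else if π.symm i < π.symm j ∧ π.symm j ≤ i then ((π.symm j : Fin n) : ℕ) - 1
        else ((π.symm j : Fin n) : ℕ)

/-- `HomesIn π k`: some sequence of exactly `k` placements leads from `π` to the identity. -/
inductive HomesIn {n : ℕ} : Equiv.Perm (Fin n) → ℕ → Prop
  | refl : HomesIn 1 0
  | step (i : Fin n) (π π' : Equiv.Perm (Fin n)) (k : ℕ) :
      IsPlacement i π π' → HomesIn π' k → HomesIn π (k + 1)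

/-- `M_n`: the permutations for which the maximum length of a sequence of placements leading to the
identity is `2 ^ (n - 1) - 1` (for `n ≥ 1`). -/
def worstCases (n : ℕ) : Set (Equiv.Perm (Fin n)) :=
  {π | IsGreatest {k : ℕ | HomesIn π k} (2 ^ (n - 1) - 1)}

/-- The Bell number `B_m`: the number of partitions of a set with `m` elements into nonempty
blocks. -/
def bellNumber (m : ℕ) : ℕ :=
  Fintype.card (Finpartition (Finset.univ : Finset (Fin m)))

/-! Upper bound. A number just placed is at home, and it can be placed from the right again only
after a smaller number, placed from the right, has pushed it past its home; the mirror statement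
holds on the left. So the word of numbers and directions is separated, and separated words in `m`
consecutive numbers have length at most `2 ^ m - 1` (`Separated.length_add_one_le`). Applied
directly to all `n` numbers this loses a factor of two. Instead the sequence is cut when the least
or greatest number first gets home: before that only the `n - 2` inner numbers are placed, and
afterwards only `n - 1` numbers are still in play, so induction gives `2 ^ (n - 1) - 1`
(`HomesVia.length_add_one_le`).

Lower bound. Sequences are built backwards from the identity. A Gray-code-like recursion
(`HomesIn.rotate_up`, `HomesIn.rotate_down`) rotates a block of `m + 1` positions in `2 ^ m - 1`
placements. A frame has a block of numbers at home. One rotation followed by one more reverse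
placement removes an end number from that block: the least one can go to any position beyond the
block, the greatest one goes to the position just before it. Counting these choices reproduces the
recursion of the Stirling numbers of the second kind. Frames with an empty block are worst cases,
and summing over the number of large elements gives the Bell number. Growth follows from `k ^ j ≤
S(k + j, k)`. -/

/-! ### Separated words and their maximal length -/

/-- A word in the letters `(i, d)`, recording that the number `i` is placed from the right of its
home (`d = true`) or from the left of it (`d = false`), is separated if an occurrence of `(i, d)`
that is preceded by a letter with the same number is separated from it by a letter with the same
direction and a smaller (`d = true`) respectively larger (`d = false`) number. -/
def Separated (w : List (ℤ × Bool)) : Prop :=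
  ∀ (x y z : List (ℤ × Bool)) (i : ℤ) (d d' : Bool), w = x ++ (i, d') :: (y ++ (i, d) :: z) →
    ∃ j, (j, d) ∈ y ∧ if d then j < i else i < j

theorem Separated.infix {p q r : List (ℤ × Bool)} (h : Separated (p ++ q ++ r)) :
    Separated q := by
  intro x y z i d d' hq
  exact h (p ++ x) y (z ++ r) i d d' (by simp [hq])

theorem Separated.filter {w : List (ℤ × Bool)} (h : Separated w) (f : ℤ × Bool → Bool)
    (hf : ∀ i j d, (i, d) ∈ w → (j, d) ∈ w → f (i, d) → (if d then j < i else i < j) →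
      f (j, d)) : Separated (w.filter f) := by
  intro x y z i d d' hw
  obtain ⟨x', w₁, rfl, rfl, h₁⟩ := List.filter_eq_append_iff.1 hw
  obtain ⟨x₂, w₂, rfl, -, -, h₂⟩ := List.filter_eq_cons_iff.1 h₁
  obtain ⟨y', w₃, rfl, rfl, h₃⟩ := List.filter_eq_append_iff.1 h₂
  obtain ⟨y₂, z', rfl, hy₂, hi, rfl⟩ := List.filter_eq_cons_iff.1 h₃
  obtain ⟨j, hj, hji⟩ := h (x' ++ x₂) (y' ++ y₂) z' i d d' (by simp)
  have hfj : f (j, d) := hf i j d (by simp) (by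
    rcases List.mem_append.1 hj with hj | hj <;> simp [hj]) hi hji
  refine ⟨j, ?_, hji⟩
  rcases List.mem_append.1 hj with hj | hj
  · exact List.mem_filter.2 ⟨hj, hfj⟩
  · exact absurd hfj (hy₂ _ hj)

/-- Reflection of a word. -/
def mirrorWord (w : List (ℤ × Bool)) : List (ℤ × Bool) := w.map fun c => (-c.1, !c.2)

theorem mirrorWord_mirrorWord (w : List (ℤ × Bool)) : mirrorWord (mirrorWord w) = w := by
  simp [mirrorWord, Function.comp_def]

theorem length_mirrorWord (w : List (ℤ × Bool)) : (mirrorWord w).length = w.length := by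
  simp [mirrorWord]

theorem mem_mirrorWord {w : List (ℤ × Bool)} {i : ℤ} {d : Bool} :
    (i, d) ∈ mirrorWord w ↔ (-i, !d) ∈ w := by
  simp only [mirrorWord, List.mem_map, Prod.mk.injEq, Prod.exists]
  constructor
  · rintro ⟨a, b, h, rfl, rfl⟩
    simpa using h
  · intro h
    exact ⟨_, _, h, by simp, by simp⟩

theorem Separated.mirror {w : List (ℤ × Bool)} (h : Separated w) : Separated (mirrorWord w) := by
  intro x y z i d d' hw
  have hw' : w = mirrorWord x ++ (-i, !d') :: (mirrorWord y ++ (-i, !d) :: mirrorWord z) := by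
    rw [← mirrorWord_mirrorWord w, hw]
    simp [mirrorWord]
  obtain ⟨j, hj, hji⟩ := h _ _ _ _ _ _ hw'
  refine ⟨-j, by simpa [mem_mirrorWord] using hj, ?_⟩
  cases d <;> simp at hji ⊢ <;> linarith

/-- If any two occurrences of `P` are separated by an occurrence of `Q`, then `P` occurs at most once
more often than `Q`, and not more often if also the first `P` is preceded by a `Q`. -/
theorem countP_le_of_separated {α : Type*} (P Q : α → Bool) (w : List α)
    (h : ∀ x a y b z, w = x ++ a :: (y ++ b :: z) → P a → P b → ∃ c ∈ y, Q c) :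
    w.countP P ≤ w.countP Q + 1 ∧
      ((∀ y b z, w = y ++ b :: z → P b → ∃ c ∈ y, Q c) → w.countP P ≤ w.countP Q) := by
  induction w with
  | nil => simp
  | cons c w ih =>
    have ih := ih fun x a y b z hw => h (c :: x) a y b z (by simp [hw])
    constructor
    · by_cases hc : P c
      · have := ih.2 fun y b z hw hb => h [] c y b z (by simp [hw]) hc hb
        rw [List.countP_cons, List.countP_cons, if_pos hc]
        omega
      · rw [List.countP_cons, List.countP_cons, if_neg hc]
        omega
    · intro h'
      have hc : ¬ P c := fun hc => by simpa using h' [] c w rfl hc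
      rw [List.countP_cons, List.countP_cons, if_neg hc]
      by_cases hq : Q c
      · rw [if_pos hq]
        omega
      · have := ih.2 fun y b z hw hb => by
          obtain ⟨e, he, hQ⟩ := h' (c :: y) b z (by simp [hw]) hb
          rcases List.mem_cons.1 he with rfl | he
          · exact absurd hQ hq
          · exact ⟨e, he, hQ⟩
        omega

/-- A separator is `(j, true)` with `j` smaller, or `(j, false)` with `j` larger, than the number it
separates. So without `(a, true)` the least number `a` never separates anything and can be deleted.
Between two occurrences of `a` some other letter remains, so `a` occurs at most once more often than
all other letters together. -/
theorem length_le_of_no_lower {w : List (ℤ × Bool)} (hw : Separated w) {a : ℤ}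
    (ha : ∀ c ∈ w, a ≤ c.1) (hno : (a, true) ∉ w) :
    Separated (w.filter fun c => c.1 ≠ a) ∧
      w.length ≤ 2 * (w.filter fun c => c.1 ≠ a).length + 1 := by
  constructor
  · apply hw.filter
    intro i j d hi hj hia hji
    cases d
    · have := ha _ hi
      simp at hji this ⊢
      omega
    · simp only [decide_not, Bool.not_eq_eq_eq_not, Bool.not_true, decide_eq_false_iff_not]
      rintro rfl
      exact hno hj
  · have h := (countP_le_of_separated (fun c : ℤ × Bool => c.1 = a) (fun c => c.1 ≠ a) w (by
      rintro x ⟨i, d⟩ y ⟨j, d'⟩ z rfl hi hj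
      simp only [decide_eq_true_eq] at hi hj
      subst hi hj
      obtain ⟨j', hj', hlt⟩ := hw x y z _ d' d rfl
      refine ⟨_, hj', ?_⟩
      cases d' <;> simp at hlt ⊢ <;> omega)).1
    have h' := List.length_eq_countP_add_countP (fun c : ℤ × Bool => decide (c.1 = a)) (l := w)
    rw [← List.countP_eq_length_filter]
    simp only [decide_not, decide_eq_true_eq] at h h' ⊢
    omega

theorem length_le_of_no_upper {w : List (ℤ × Bool)} (hw : Separated w) {b : ℤ}
    (hb : ∀ c ∈ w, c.1 ≤ b) (hno : (b, false) ∉ w) :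
    Separated (w.filter fun c => c.1 ≠ b) ∧
      w.length ≤ 2 * (w.filter fun c => c.1 ≠ b).length + 1 := by
  have key := length_le_of_no_lower hw.mirror (a := -b) (by
    rintro ⟨i, d⟩ hc
    have := hb _ (mem_mirrorWord.1 hc)
    simp at this ⊢
    omega) (by simpa [mem_mirrorWord] using hno)
  have e : (mirrorWord w).filter (fun c => c.1 ≠ -b) = mirrorWord (w.filter fun c => c.1 ≠ b) := by
    simp [mirrorWord, List.filter_map, Function.comp_def]
  rw [e, length_mirrorWord, length_mirrorWord] at key
  exact ⟨by simpa [mirrorWord_mirrorWord] using key.1.mirror, key.2⟩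

/-- A separated word that starts with `(a, true)` where `a` is the least number. -/
theorem length_le_of_head_lower {u : List (ℤ × Bool)} {a b : ℤ} (hab : a < b)
    (hw : Separated ((a, true) :: u)) (hr : ∀ c ∈ u, a ≤ c.1 ∧ c.1 ≤ b) (hno : (b, false) ∉ u) :
    Separated (u.filter fun c => c.1 ≠ a ∧ c.1 ≠ b) ∧
      u.length ≤ 2 * (u.filter fun c => c.1 ≠ a ∧ c.1 ≠ b).length + 1 := by
  have hu : Separated u := by
    have : (a, true) :: u = [(a, true)] ++ u ++ [] := by simp
    rw [this] at hw
    exact hw.infix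
  have hno' : (a, true) ∉ u := by
    intro h
    obtain ⟨y, z, rfl⟩ := List.append_of_mem h
    obtain ⟨j, hj, hlt⟩ := hw [] y z a true true rfl
    have := hr (j, true) (by simp [hj])
    simp at hlt this
    omega
  constructor
  · apply hu.filter
    intro i j d hi hj hia hji
    have hi' := hr _ hi
    have hj' := hr _ hj
    simp only [ne_eq, Bool.decide_and, decide_not, Bool.and_eq_true, Bool.not_eq_eq_eq_not,
      Bool.not_true, decide_eq_false_iff_not] at hia hi' hj' ⊢
    cases d
    · refine ⟨?_, fun h => hno (h ▸ hj)⟩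
      simp at hji
      omega
    · refine ⟨fun h => hno' (h ▸ hj), ?_⟩
      simp at hji
      omega
  -- Only `(a, false)` can occur in `u`, so occurrences of `a` are separated by inner letters with
  -- direction `false`. The head is included in the count: it absorbs the extra `1`.
  · have h₁ := (countP_le_of_separated (fun c : ℤ × Bool => c.1 = a)
        (fun c => (c.1 ≠ a ∧ c.1 ≠ b) ∧ c.2 = false) ((a, true) :: u) (by
      rintro x ⟨i, d⟩ y ⟨j, d'⟩ z hs hi hj
      simp only [decide_eq_true_eq] at hi hj
      subst hi hj
      obtain ⟨j', hj', hlt⟩ := hw x y z _ d' d hs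
      have hm : (j', d') ∈ u := by
        rcases x with _ | ⟨c, x⟩ <;> simp at hs
        · rw [hs.2]; simp [hj']
        · rw [hs.2]; simp [hj']
      have hm' := hr _ hm
      refine ⟨_, hj', ?_⟩
      cases d'
      · simp at hlt ⊢
        refine ⟨by omega, fun h => hno (h ▸ hm)⟩
      · simp at hlt hm'
        omega)).1
    -- Symmetrically, `b` is separated by inner letters with direction `true`. The two kinds are
    -- disjoint, so `a` and `b` together are charged to each inner letter only once.
    have h₂ := (countP_le_of_separated (fun c : ℤ × Bool => c.1 = b)
        (fun c => (c.1 ≠ a ∧ c.1 ≠ b) ∧ c.2 = true) u (by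
      rintro x ⟨i, d⟩ y ⟨j, d'⟩ z hs hi hj
      simp only [decide_eq_true_eq] at hi hj
      subst hi hj
      obtain ⟨j', hj', hlt⟩ := hu x y z _ d' d hs
      have hm : (j', d') ∈ u := by
        rw [hs]; simp [hj']
      have hm' := hr _ hm
      refine ⟨_, hj', ?_⟩
      cases d'
      · simp at hlt hm'
        omega
      · simp at hlt ⊢
        refine ⟨fun h => hno' (h ▸ hm), by omega⟩)).1
    have key : ∀ v : List (ℤ × Bool), v.length = v.countP (fun c => decide (c.1 = a)) +
        v.countP (fun c => decide (c.1 = b)) + (v.filter fun c => c.1 ≠ a ∧ c.1 ≠ b).length ∧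
        (v.filter fun c => c.1 ≠ a ∧ c.1 ≠ b).length =
          v.countP (fun c => (c.1 ≠ a ∧ c.1 ≠ b) ∧ c.2 = false) +
          v.countP (fun c => (c.1 ≠ a ∧ c.1 ≠ b) ∧ c.2 = true) := by
      intro v
      induction v with
      | nil => simp
      | cons c v ih =>
        obtain ⟨i, d⟩ := c
        simp only [← List.countP_eq_length_filter, List.countP_cons, List.length_cons, ne_eq,
          Bool.decide_and, decide_not, Bool.decide_eq_true, Bool.decide_eq_false] at ih ⊢
        rcases eq_or_ne i a with rfl | hia
        · simp [hab.ne]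
          omega
        · rcases eq_or_ne i b with rfl | hib
          · simp [hia]
            omega
          · cases d <;> simp [hia, hib] <;> omega
    have := key u
    simp only [List.countP_cons] at h₁
    simp at h₁
    simp at h₁ h₂ this ⊢
    omega

/-- Nothing can separate `(a, true)` from an earlier `a`, so `v` avoids `a` and has at most `2 ^ (m
- 1) - 1` letters. As `(b, false)`, with `b` the greatest number, cannot recur in `u`, both extremes
can be deleted there, and `u` obeys the same bound. -/
theorem length_le_of_lower_of_upper {m : ℕ} (a : ℤ)
    (ih : ∀ k < m, ∀ (a : ℤ) (w : List (ℤ × Bool)), Separated w →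
      (∀ c ∈ w, a ≤ c.1 ∧ c.1 < a + k) → w.length + 1 ≤ 2 ^ k)
    (hm : 2 ≤ m) (v u : List (ℤ × Bool)) (hw : Separated (v ++ (a, true) :: u))
    (hr : ∀ c ∈ v ++ (a, true) :: u, a ≤ c.1 ∧ c.1 < a + m) (hv : (a + m - 1, false) ∈ v) :
    (v ++ (a, true) :: u).length + 1 ≤ 2 ^ m := by
  obtain ⟨m, rfl⟩ : ∃ k, m = k + 2 := ⟨m - 2, by omega⟩
  push_cast at *
  have hva : ∀ d, (a, d) ∉ v := by
    intro d h
    obtain ⟨x, y, rfl⟩ := List.append_of_mem h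
    obtain ⟨j, hj, hlt⟩ := hw x y u a true d (by simp)
    have := hr (j, true) (by simp [hj])
    simp at hlt this
    omega
  have h₁ := ih (m + 1) (by omega) (a + 1) v
    (Separated.infix (p := []) (r := (a, true) :: u) (by simpa using hw)) (by
      rintro ⟨i, d⟩ hc
      have := hr (i, d) (by simp [hc])
      have hne : i ≠ a := by
        rintro rfl
        exact hva d hc
      simp at this ⊢
      omega)
  have hub : (a + m + 1, false) ∉ u := by
    intro h
    obtain ⟨x, y, rfl⟩ := List.append_of_mem hv
    obtain ⟨y', z, rfl⟩ := List.append_of_mem h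
    obtain ⟨j, hj, hlt⟩ := hw x (y ++ (a, true) :: y') z (a + m + 1) false false (by
      simp; ring)
    have := hr (j, false) (by
      simp at hj
      simp
      tauto)
    simp at hlt this
    omega
  have h₂ := length_le_of_head_lower (a := a) (b := a + m + 1) (u := u) (by omega)
    (Separated.infix (p := v) (r := []) (by simpa using hw)) (by
      intro c hc
      have := hr c (by simp [hc])
      omega) hub
  have h₃ := ih m (by omega) (a + 1) _ h₂.1 (by
    intro c hc
    rw [List.mem_filter] at hc
    have := hr c (by simp [hc.1])
    have h' := hc.2
    simp at h'
    omega)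
  have h₂' := h₂.2
  rw [List.length_append, List.length_cons]
  have : (2:ℕ) ^ (m + 2) = 4 * 2 ^ m := by ring
  have : (2:ℕ) ^ (m + 1) = 2 * 2 ^ m := by ring
  omega

/-- A separated word in `m` consecutive numbers has length at most `2 ^ m - 1`. -/
theorem Separated.length_add_one_le (m : ℕ) : ∀ (a : ℤ) (w : List (ℤ × Bool)), Separated w →
    (∀ c ∈ w, a ≤ c.1 ∧ c.1 < a + m) → w.length + 1 ≤ 2 ^ m := by
  induction m using Nat.strong_induction_on with
  | _ m ih =>
  intro a w hw hr
  rcases Nat.eq_zero_or_pos m with rfl | hm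
  · rcases w with _ | ⟨c, w⟩
    · simp
    · have := hr c (by simp)
      simp at this
      omega
  obtain ⟨m, rfl⟩ : ∃ k, m = k + 1 := ⟨m - 1, by omega⟩
  have h2 : (2:ℕ) ^ (m + 1) = 2 * 2 ^ m := by ring
  push_cast at hr
  by_cases hlo : (a, true) ∈ w
  swap
  · have h := length_le_of_no_lower hw (fun c hc => (hr c hc).1) hlo
    have := ih m (by omega) (a + 1) _ h.1 (by
      intro c hc
      rw [List.mem_filter] at hc
      have := hr c hc.1
      have h' := hc.2
      simp at h'
      omega)
    have := h.2
    omega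
  by_cases hhi : (a + m, false) ∈ w
  swap
  · have h := length_le_of_no_upper hw (b := a + m) (fun c hc => by have := hr c hc; omega) hhi
    have := ih m (by omega) a _ h.1 (by
      intro c hc
      rw [List.mem_filter] at hc
      have := hr c hc.1
      have h' := hc.2
      simp at h'
      omega)
    have := h.2
    omega
  -- With a single number, its two letters would need a separator with a different number.
  have hm : 2 ≤ m + 1 := by
    by_contra hm
    obtain rfl : m = 0 := by omega
    simp at hhi
    obtain ⟨x, y, rfl⟩ := List.append_of_mem hlo
    have hcase : (∃ p q r d d', x ++ (a, true) :: y = p ++ (a, d') :: (q ++ (a, d) :: r)) := by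
      simp at hhi
      rcases hhi with h | h
      · obtain ⟨p, q, rfl⟩ := List.append_of_mem h
        exact ⟨p, q, y, true, false, by simp⟩
      · obtain ⟨p, q, rfl⟩ := List.append_of_mem h
        exact ⟨x, p, q, false, true, by simp⟩
    obtain ⟨p, q, r, d, d', he⟩ := hcase
    obtain ⟨j, hj, hlt⟩ := hw p q r a d d' he
    have := hr (j, d) (by rw [he]; simp [hj])
    cases d <;> simp at this hlt <;> omega
  obtain ⟨v, u, rfl⟩ := List.append_of_mem hlo
  rcases List.mem_append.1 hhi with hv | hu
  · exact length_le_of_lower_of_upper a ih hm v u hw (by push_cast; exact hr)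
      (by push_cast; simpa [← add_assoc] using hv)
  · have hu : (a + m, false) ∈ u := by simpa using hu
    obtain ⟨y, z, rfl⟩ := List.append_of_mem hu
    -- Reflection exchanges `(a, true)` and `(a + m, false)` up to sign, which reduces the other
    -- order to the one already treated.
    have e : mirrorWord (v ++ (a, true) :: (y ++ (a + m, false) :: z)) =
        mirrorWord (v ++ (a, true) :: y) ++ (-(a + m), true) :: mirrorWord z := by
      simp [mirrorWord]
    have := length_le_of_lower_of_upper (-(a + m)) ih hm (mirrorWord (v ++ (a, true) :: y))
      (mirrorWord z) (e ▸ hw.mirror) (by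
        rw [← e]
        rintro ⟨i, d⟩ hc
        have := hr _ (mem_mirrorWord.1 hc)
        push_cast
        simp at this ⊢
        omega) (by
        simp only [mem_mirrorWord, List.mem_append, List.mem_cons, Prod.mk.injEq]
        exact Or.inr (Or.inl ⟨by push_cast; ring, rfl⟩))
    rw [← e, length_mirrorWord] at this
    exact this

/-! ### Words of placement sequences are separated -/

/-- A sequence of placements from `π` to the identity, together with the word that records the
number and the direction of each placement. -/
inductive HomesVia {n : ℕ} : Equiv.Perm (Fin n) → List (ℤ × Bool) → Prop
  | refl : HomesVia 1 []
  | step (i : Fin n) (π π' : Equiv.Perm (Fin n)) (w : List (ℤ × Bool)) :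
      IsPlacement i π π' → HomesVia π' w →
        HomesVia π ((((i : ℕ) : ℤ), decide (i < π.symm i)) :: w)

theorem HomesIn.exists_homesVia {n k : ℕ} {π : Equiv.Perm (Fin n)} (h : HomesIn π k) :
    ∃ w, HomesVia π w ∧ w.length = k := by
  induction h with
  | refl => exact ⟨[], .refl, rfl⟩
  | step i π π' k hp _ ih =>
    obtain ⟨w, hw, rfl⟩ := ih
    exact ⟨_, .step i π π' w hp hw, rfl⟩

namespace IsPlacement

variable {n : ℕ} {i : Fin n} {π π' : Equiv.Perm (Fin n)}

theorem symm_ne (h : IsPlacement i π π') : π.symm i ≠ i := by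
  intro e
  exact h.1 (by rw [← e, Equiv.apply_symm_apply, e])

theorem symm_self (h : IsPlacement i π π') : π'.symm i = i := by
  rw [Equiv.symm_apply_eq, h.2.1]

theorem symm_of_ne (h : IsPlacement i π π') {j : Fin n} (hj : j ≠ i) :
    π.symm j ≠ π.symm i ∧ ((π'.symm j : Fin n) : ℕ) =
      if (i : ℕ) ≤ π.symm j ∧ (π.symm j : ℕ) < π.symm i then (π.symm j : ℕ) + 1
        else if (π.symm i : ℕ) < π.symm j ∧ (π.symm j : ℕ) ≤ i then (π.symm j : ℕ) - 1
        else (π.symm j : ℕ) := by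
  refine ⟨fun e => hj (π.symm.injective e), ?_⟩
  simpa only [Fin.le_def, Fin.lt_def] using h.2.2 j hj

/-- A shift changes a position by one, so `j` was exactly at home and was pushed right; this takes a
placement from the right at a home left of `j`. -/
theorem cross_right (h : IsPlacement i π π') {j : Fin n} (h₁ : π.symm j ≤ j)
    (h₂ : j < π'.symm j) : i < j ∧ i < π.symm i := by
  have hj : j ≠ i := by
    rintro rfl
    simp [h.symm_self] at h₂
  obtain ⟨-, h'⟩ := h.symm_of_ne hj
  have : (j : ℕ) ≠ i := fun e => hj (Fin.ext e)
  rw [Fin.le_def] at h₁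
  rw [Fin.lt_def] at h₂ ⊢
  rw [Fin.lt_def]
  split_ifs at h' <;> omega

theorem cross_left (h : IsPlacement i π π') {j : Fin n} (h₁ : j ≤ π.symm j)
    (h₂ : π'.symm j < j) : j < i ∧ ¬ i < π.symm i := by
  have hj : j ≠ i := by
    rintro rfl
    simp [h.symm_self] at h₂
  obtain ⟨-, h'⟩ := h.symm_of_ne hj
  have : (j : ℕ) ≠ i := fun e => hj (Fin.ext e)
  rw [Fin.le_def] at h₁
  rw [Fin.lt_def] at h₂ ⊢
  rw [Fin.lt_def]
  split_ifs at h' <;> omega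

/-- The placed number and its old position both lie in `[a, b]`, hence so does everything that is
shifted. -/
theorem fixes_outside (h : IsPlacement i π π') {a b : ℕ}
    (hπ : ∀ j : Fin n, (j : ℕ) < a ∨ b < j → π.symm j = j) :
    (a ≤ i ∧ i ≤ b) ∧ ∀ j : Fin n, (j : ℕ) < a ∨ b < j → π'.symm j = j := by
  have hi : a ≤ i ∧ i ≤ b := by
    by_contra hi
    exact h.symm_ne (hπ i (by omega))
  have hp : a ≤ (π.symm i : ℕ) ∧ (π.symm i : ℕ) ≤ b := by
    by_contra hp
    have := hπ (π.symm i) (by omega)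
    exact h.symm_ne (π.symm.injective this)
  refine ⟨hi, fun j hj => ?_⟩
  have hji : j ≠ i := by
    rintro rfl
    omega
  obtain ⟨-, h'⟩ := h.symm_of_ne hji
  rw [hπ j hj] at h'
  rw [Fin.ext_iff]
  split_ifs at h' <;> omega

end IsPlacement

namespace HomesVia

variable {n : ℕ} {π : Equiv.Perm (Fin n)} {w : List (ℤ × Bool)}

/-- To be placed from the right, `i` must first cross its home to the right; the crossing placement
is the required letter. -/
theorem exists_of_right (h : HomesVia π w) (i : Fin n) (hi : π.symm i ≤ i)
    (y z : List (ℤ × Bool)) (hw : w = y ++ (((i : ℕ) : ℤ), true) :: z) :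
    ∃ j, (j, true) ∈ y ∧ j < ((i : ℕ) : ℤ) := by
  induction h generalizing y with
  | refl => simp at hw
  | step j π π' w hp _ ih =>
    rcases y with _ | ⟨c, y⟩
    · simp only [List.nil_append, List.cons.injEq, Prod.mk.injEq, Nat.cast_inj,
        decide_eq_true_eq] at hw
      obtain ⟨⟨h₁, h₂⟩, -⟩ := hw
      obtain rfl : j = i := Fin.ext h₁
      exact absurd hi (not_le.2 h₂)
    · simp only [List.cons_append, List.cons.injEq] at hw
      by_cases h' : π'.symm i ≤ i
      · obtain ⟨l, hl, hli⟩ := ih h' y hw.2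
        exact ⟨l, by simp [hl], hli⟩
      · obtain ⟨h₁, h₂⟩ := hp.cross_right hi (not_le.1 h')
        refine ⟨((j : ℕ) : ℤ), ?_, by exact_mod_cast h₁⟩
        rw [← hw.1]
        simp [h₂]

theorem exists_of_left (h : HomesVia π w) (i : Fin n) (hi : i ≤ π.symm i)
    (y z : List (ℤ × Bool)) (hw : w = y ++ (((i : ℕ) : ℤ), false) :: z) :
    ∃ j, (j, false) ∈ y ∧ ((i : ℕ) : ℤ) < j := by
  induction h generalizing y with
  | refl => simp at hw
  | step j π π' w hp _ ih =>
    rcases y with _ | ⟨c, y⟩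
    · simp only [List.nil_append, List.cons.injEq, Prod.mk.injEq, Nat.cast_inj,
        decide_eq_false_iff_not] at hw
      obtain ⟨⟨h₁, h₂⟩, -⟩ := hw
      obtain rfl : j = i := Fin.ext h₁
      exact absurd (le_antisymm (not_lt.1 h₂) hi) hp.symm_ne
    · simp only [List.cons_append, List.cons.injEq] at hw
      by_cases h' : i ≤ π'.symm i
      · obtain ⟨l, hl, hli⟩ := ih h' y hw.2
        exact ⟨l, by simp [hl], hli⟩
      · obtain ⟨h₁, h₂⟩ := hp.cross_left hi (not_le.1 h')
        refine ⟨((j : ℕ) : ℤ), ?_, by exact_mod_cast h₁⟩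
        rw [← hw.1]
        simp [h₂]

theorem separated (h : HomesVia π w) : Separated w := by
  induction h with
  | refl => intro x y z i d d' hw; simp at hw
  | step j π π' w hp hv ih =>
    intro x y z i d d' hw
    rcases x with _ | ⟨c, x⟩
    · simp only [List.nil_append, List.cons.injEq, Prod.mk.injEq] at hw
      obtain ⟨⟨rfl, -⟩, hw⟩ := hw
      cases d
      · simpa using hv.exists_of_left j hp.symm_self.ge y z hw
      · simpa using hv.exists_of_right j hp.symm_self.le y z hw
    · simp only [List.cons_append, List.cons.injEq] at hw
      exact ih x y z i d d' hw.2

/-! ### The upper bound -/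

/-- The cut is at the first moment when `a` or `b` is at home. Placing either of them would bring it
home, so `v` involves only numbers strictly between; the letter `c` is the placement that reaches
this moment. -/
theorem exists_split (h : HomesVia π w) (a b : Fin n)
    (hπ : ∀ j : Fin n, (j : ℕ) < a ∨ (b : ℕ) < j → π.symm j = j) :
    (π.symm a = a ∨ π.symm b = b) ∨ ∃ v c u π', w = v ++ c :: u ∧
      (∀ c ∈ v, ((a : ℕ) : ℤ) < c.1 ∧ c.1 < ((b : ℕ) : ℤ)) ∧ HomesVia π' u ∧
      (∀ j : Fin n, (j : ℕ) < a ∨ (b : ℕ) < j → π'.symm j = j) ∧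
      (π'.symm a = a ∨ π'.symm b = b) := by
  induction h with
  | refl => exact Or.inl (Or.inl rfl)
  | step i π π' w hp hv ih =>
    obtain ⟨hi, hπ'⟩ := hp.fixes_outside hπ
    rcases ih hπ' with h | ⟨v, c, u, σ, rfl, hvr, hu, hσ, hab⟩
    · exact Or.inr ⟨[], _, w, π', rfl, by simp, hv, hπ', h⟩
    · by_cases hh : π'.symm a = a ∨ π'.symm b = b
      · exact Or.inr ⟨[], _, _, π', rfl, by simp, hv, hπ', hh⟩
      · refine Or.inr ⟨_ :: v, c, u, σ, rfl, ?_, hu, hσ, hab⟩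
        intro e he
        rcases List.mem_cons.1 he with rfl | he
        · have ha : i ≠ a := by
            rintro rfl
            exact hh (Or.inl hp.symm_self)
          have hb : i ≠ b := by
            rintro rfl
            exact hh (Or.inr hp.symm_self)
          rw [ne_eq, Fin.ext_iff] at ha hb
          simp only
          omega
        · exact hvr e he

theorem eq_nil (h : HomesVia (1 : Equiv.Perm (Fin n)) w) : w = [] := by
  generalize hσ : (1 : Equiv.Perm (Fin n)) = σ at h
  cases h with
  | refl => rfl
  | step i _ π' w hp _ => exact absurd (by rw [← hσ]; rfl) hp.1

/-- Once an endpoint is at home it can be dropped from the interval, because numbers outside the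
interval stay fixed. The part before the cut is bounded by the word estimate, the part after it by
induction. -/
theorem length_add_one_le (m : ℕ) : ∀ (a b : Fin n) (π : Equiv.Perm (Fin n)) (w),
    (b : ℕ) = a + m → HomesVia π w →
    (∀ j : Fin n, (j : ℕ) < a ∨ (b : ℕ) < j → π.symm j = j) → w.length + 1 ≤ 2 ^ m := by
  induction m with
  | zero =>
    intro a b π w hab h hπ
    have hb : π.symm b = b := by
      by_contra hb
      have hne : (π.symm b : ℕ) ≠ b := fun e => hb (Fin.ext e)
      have := hπ (π.symm b) (by omega)
      exact hb (π.symm.injective this)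
    have : π = 1 := by
      rw [← inv_eq_one, Equiv.Perm.inv_def]
      ext j
      by_cases hj : (j : ℕ) < a ∨ (b : ℕ) < j
      · rw [hπ j hj]; rfl
      · obtain rfl : j = b := Fin.ext (by omega)
        rw [hb]; rfl
    subst this
    simp [h.eq_nil]
  | succ m ih =>
    have step : ∀ (a b : Fin n) (π : Equiv.Perm (Fin n)) (w), (b : ℕ) = a + (m + 1) →
        HomesVia π w → (∀ j : Fin n, (j : ℕ) < a ∨ (b : ℕ) < j → π.symm j = j) →
        (π.symm a = a ∨ π.symm b = b) → w.length + 1 ≤ 2 ^ m := by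
      intro a b π w hab h hπ hh
      have hb := b.isLt
      rcases hh with hh | hh
      · refine ih ⟨a + 1, by omega⟩ b π w (by simp; omega) h fun j hj => ?_
        by_cases hja : j = a
        · rw [hja, hh]
        · rw [Fin.ext_iff] at hja
          simp at hj
          exact hπ j (by omega)
      · refine ih a ⟨b - 1, by omega⟩ π w (by simp; omega) h fun j hj => ?_
        by_cases hjb : j = b
        · rw [hjb, hh]
        · rw [Fin.ext_iff] at hjb
          simp at hj
          exact hπ j (by omega)
    intro a b π w hab h hπ
    have h2 : (2:ℕ) ^ (m + 1) = 2 * 2 ^ m := by ring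
    rcases h.exists_split a b hπ with hh | ⟨v, c, u, π', rfl, hv, hu, hπ', hh⟩
    · have := step a b π w hab h hπ hh
      omega
    · have h₁ := step a b π' u hab hu hπ' hh
      have h₂ := Separated.length_add_one_le m (a + 1) v
        (Separated.infix (p := []) (r := c :: u) (by simpa using h.separated)) (by
          intro e he
          have := hv e he
          omega)
      rw [List.length_append, List.length_cons]
      omega

end HomesVia

/-- Every sequence of placements from a permutation of `n` numbers to the identity has length at
most `2 ^ (n - 1) - 1`. -/
theorem HomesIn.le {n k : ℕ} (hn : 1 ≤ n) {π : Equiv.Perm (Fin n)} (h : HomesIn π k) :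
    k ≤ 2 ^ (n - 1) - 1 := by
  obtain ⟨w, hw, rfl⟩ := h.exists_homesVia
  have := HomesVia.length_add_one_le (n - 1) ⟨0, by omega⟩ ⟨n - 1, by omega⟩ π w (by simp) hw
    fun j hj => by
      have := j.isLt
      simp at hj
      omega
  omega

/-! ### Placements in reverse and rotations of blocks -/

/-- The value of `x` after the point at `i` is moved to `q`, where the points between are shifted by
one towards `i`. -/
def shiftNat (i q x : ℕ) : ℕ :=
  if x = i then q else if i < x ∧ x ≤ q then x - 1 else if q ≤ x ∧ x < i then x + 1 else x

theorem shiftNat_lt {n i q x : ℕ} (hq : q < n) (hi : i < n) (hx : x < n) :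
    shiftNat i q x < n := by
  unfold shiftNat
  split_ifs <;> omega

theorem shiftNat_shiftNat (i q x : ℕ) : shiftNat q i (shiftNat i q x) = x := by
  unfold shiftNat
  split_ifs <;> omega

/-- The permutation of the positions that moves `i` to `q` and shifts the positions between. -/
def movePos {n : ℕ} (i q : Fin n) : Equiv.Perm (Fin n) where
  toFun x := ⟨shiftNat i q x, shiftNat_lt q.2 i.2 x.2⟩
  invFun x := ⟨shiftNat q i x, shiftNat_lt i.2 q.2 x.2⟩
  left_inv _ := Fin.ext (shiftNat_shiftNat _ _ _)
  right_inv _ := Fin.ext (shiftNat_shiftNat _ _ _)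

section

variable {n : ℕ}

theorem movePos_val (i q x : Fin n) : (movePos i q x : ℕ) =
    if (x : ℕ) = i then (q : ℕ) else if (i : ℕ) < x ∧ (x : ℕ) ≤ q then (x : ℕ) - 1
      else if (q : ℕ) ≤ x ∧ (x : ℕ) < i then (x : ℕ) + 1 else x := rfl

theorem symm_mul_movePos (π : Equiv.Perm (Fin n)) (i q x : Fin n) :
    (π * movePos q i).symm x = movePos i q (π.symm x) := rfl

/-- A number at home may be taken to any other position `q`; placing it undoes this. Right
multiplication by `movePos q i` thus prepends a placement to a sequence. -/
theorem isPlacement_mul_movePos {π : Equiv.Perm (Fin n)} {i q : Fin n} (hi : π i = i)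
    (hq : q ≠ i) : IsPlacement i (π * movePos q i) π := by
  have hi' : π.symm i = i := by rw [Equiv.symm_apply_eq, hi]
  have hpos : (π * movePos q i).symm i = q := by
    rw [symm_mul_movePos, hi', Fin.ext_iff, movePos_val, if_pos rfl]
  refine ⟨fun h => hq ?_, hi, fun j hj => ?_⟩
  · rw [← hpos, Equiv.symm_apply_eq, h]
  · rw [hpos, symm_mul_movePos]
    have hne : (π.symm j : ℕ) ≠ i := by
      intro h
      apply hj
      rw [← hi, ← Fin.ext h, Equiv.apply_symm_apply]
    simp only [Fin.le_def, Fin.lt_def, movePos_val, if_neg hne]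
    split_ifs <;> omega

theorem HomesIn.mul_movePos {π : Equiv.Perm (Fin n)} {k : ℕ} (h : HomesIn π k) {i q : Fin n}
    (hi : π i = i) (hq : q ≠ i) : HomesIn (π * movePos q i) (k + 1) :=
  .step i _ π k (isPlacement_mul_movePos hi hq) h

theorem movePos_self (i : Fin n) : movePos i i = 1 := by
  ext x
  rw [movePos_val, Equiv.Perm.one_apply]
  split_ifs <;> omega

/-- Rotating the shorter block, moving `a` to the far end and rotating the shorter block again
rotates the whole block: the first rotation's shift is undone by the move of `a`. -/
theorem movePos_eq_mul_up {a a' e : Fin n} (ha : (a' : ℕ) = a + 1) (he : a < e) :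
    movePos a e = movePos a' e * movePos e a * movePos a' e := by
  ext x
  rw [Fin.lt_def] at he
  rw [Equiv.Perm.mul_apply, Equiv.Perm.mul_apply]
  have h₀ := movePos_val a e x
  have h₁ := movePos_val a' e x
  have h₂ := movePos_val e a (movePos a' e x)
  have h₃ := movePos_val a' e (movePos e a (movePos a' e x))
  generalize movePos a' e (movePos e a (movePos a' e x)) = w at *
  generalize movePos e a (movePos a' e x) = z at *
  generalize movePos a' e x = y at *
  generalize movePos a e x = v at *
  split_ifs at h₀ <;> split_ifs at h₁ <;> (try omega) <;> split_ifs at h₂ <;> (try omega) <;>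
    split_ifs at h₃ <;> omega

theorem movePos_eq_mul_down {b b' e : Fin n} (hb : (b : ℕ) = b' + 1) (he : e < b) :
    movePos b e = movePos b' e * movePos e b * movePos b' e := by
  ext x
  rw [Fin.lt_def] at he
  rw [Equiv.Perm.mul_apply, Equiv.Perm.mul_apply]
  have h₀ := movePos_val b e x
  have h₁ := movePos_val b' e x
  have h₂ := movePos_val e b (movePos b' e x)
  have h₃ := movePos_val b' e (movePos e b (movePos b' e x))
  generalize movePos b' e (movePos e b (movePos b' e x)) = w at *
  generalize movePos e b (movePos b' e x) = z at *
  generalize movePos b' e x = y at *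
  generalize movePos b e x = v at *
  split_ifs at h₀ <;> split_ifs at h₁ <;> (try omega) <;> split_ifs at h₂ <;> (try omega) <;>
    split_ifs at h₃ <;> omega

/-- Two rotations of the shorter block and one move of `a` give the recursion `2 * (2 ^ m - 1) + 1 =
2 ^ (m + 1) - 1`. After the first two of these steps the block's numbers other than `a` are at home
again, as the second rotation requires. -/
theorem HomesIn.rotate_up (m : ℕ) : ∀ {π : Equiv.Perm (Fin n)} {k : ℕ} (_ : HomesIn π k)
    {a e : Fin n} (_ : (e : ℕ) = a + m) (_ : ∀ j, a ≤ j → j < e → π j = j),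
    HomesIn (π * movePos a e) (k + (2 ^ m - 1)) := by
  induction m with
  | zero =>
    intro π k h a e he _
    obtain rfl : e = a := Fin.ext he
    simpa [movePos_self] using h
  | succ m ih =>
    intro π k h a e he hfix
    have hae : a < e := by rw [Fin.lt_def]; omega
    let a' : Fin n := ⟨a + 1, by have := e.2; omega⟩
    have ha' : (a' : ℕ) = a + 1 := rfl
    rw [movePos_eq_mul_up ha' hae, ← mul_assoc, ← mul_assoc]
    have h₁ := ih h (a := a') (e := e) (by omega) fun j hj hj' => hfix j (by
      rw [Fin.le_def] at hj ⊢; omega) hj'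
    have h₂ := h₁.mul_movePos (i := a) (q := e) (by
      rw [Equiv.Perm.mul_apply]
      convert! hfix a le_rfl hae using 2
      rw [Fin.ext_iff, movePos_val]
      rw [Fin.lt_def] at hae
      split_ifs <;> omega) hae.ne'
    have h₃ := ih h₂ (a := a') (e := e) (by omega) fun j hj hj' => by
      rw [Equiv.Perm.mul_apply, Equiv.Perm.mul_apply]
      convert! hfix j (by rw [Fin.le_def] at hj ⊢; omega) hj' using 2
      rw [Fin.ext_iff, movePos_val, movePos_val]
      rw [Fin.lt_def] at hae hj'
      rw [Fin.le_def] at hj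
      split_ifs <;> omega
    convert! h₃ using 1
    have := Nat.one_le_two_pow (n := m)
    rw [pow_succ]
    omega

theorem HomesIn.rotate_down (m : ℕ) : ∀ {π : Equiv.Perm (Fin n)} {k : ℕ} (_ : HomesIn π k)
    {b e : Fin n} (_ : (b : ℕ) = e + m) (_ : ∀ j, e < j → j ≤ b → π j = j),
    HomesIn (π * movePos b e) (k + (2 ^ m - 1)) := by
  induction m with
  | zero =>
    intro π k h b e he _
    obtain rfl : b = e := Fin.ext he
    simpa [movePos_self] using h
  | succ m ih =>
    intro π k h b e he hfix
    have heb : e < b := by rw [Fin.lt_def]; omega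
    let b' : Fin n := ⟨b - 1, by have := b.2; omega⟩
    have hb' : (b' : ℕ) = b - 1 := rfl
    rw [movePos_eq_mul_down (b' := b') (by omega) heb, ← mul_assoc, ← mul_assoc]
    have h₁ := ih h (b := b') (e := e) (by omega) fun j hj hj' => hfix j hj (by
      rw [Fin.le_def] at hj' ⊢; omega)
    have h₂ := h₁.mul_movePos (i := b) (q := e) (by
      rw [Equiv.Perm.mul_apply]
      convert! hfix b heb le_rfl using 2
      rw [Fin.ext_iff, movePos_val]
      rw [Fin.lt_def] at heb
      split_ifs <;> omega) heb.ne
    have h₃ := ih h₂ (b := b') (e := e) (by omega) fun j hj hj' => by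
      rw [Equiv.Perm.mul_apply, Equiv.Perm.mul_apply]
      convert! hfix j hj (by rw [Fin.le_def] at hj' ⊢; omega) using 2
      rw [Fin.ext_iff, movePos_val, movePos_val]
      rw [Fin.lt_def] at heb hj
      rw [Fin.le_def] at hj'
      split_ifs <;> omega
    convert! h₃ using 1
    have := Nat.one_le_two_pow (n := m)
    rw [pow_succ]
    omega

/-! ### Frames and their number -/

/-- A permutation from which `2 ^ (n - 1) - 2 ^ m` placements are possible, where the `m` numbers
from `A` on are at home, the smaller numbers are to the right and the larger ones to the left of
their homes, and the least of the latter is in one of the first `A` positions. -/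
structure IsFrame (A m : ℕ) (σ : Equiv.Perm (Fin n)) : Prop where
  inner : ∀ j : Fin n, A ≤ j → (j : ℕ) < A + m → σ.symm j = j
  lower : ∀ j : Fin n, (j : ℕ) < A → (j : ℕ) < σ.symm j
  upper : ∀ j : Fin n, A + m ≤ j → (σ.symm j : ℕ) < j
  next : ∀ j : Fin n, (j : ℕ) = A + m → (σ.symm j : ℕ) < A
  homes : HomesIn σ (2 ^ (n - 1) - 2 ^ m)

theorem IsFrame.apply_inner {A m : ℕ} {σ : Equiv.Perm (Fin n)} (h : IsFrame A m σ) (j : Fin n)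
    (h₁ : A ≤ j) (h₂ : (j : ℕ) < A + m) : σ j = j := by
  rw [← Equiv.eq_symm_apply, h.inner j h₁ h₂]

theorem IsFrame.symm_outer {A m : ℕ} {σ : Equiv.Perm (Fin n)} (h : IsFrame A m σ) (j : Fin n)
    (hj : (j : ℕ) < A ∨ A + m ≤ j) : (σ.symm j : ℕ) < A ∨ A + m ≤ σ.symm j := by
  by_contra hc
  have := h.apply_inner (σ.symm j) (by omega) (by omega)
  rw [Equiv.apply_symm_apply] at this
  rw [← this] at hc
  omega

theorem HomesIn.of_succ {m k : ℕ} {τ : Equiv.Perm (Fin n)}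
    (hn : m + 1 ≤ n - 1) (hk : k = 2 ^ (n - 1) - 2 ^ (m + 1) + (2 ^ m - 1) + 1)
    (hτ : HomesIn τ k) : HomesIn τ (2 ^ (n - 1) - 2 ^ m) := by
  convert! hτ using 1
  have := Nat.pow_le_pow_right (n := 2) (by norm_num) hn
  have := Nat.one_le_two_pow (n := m)
  rw [pow_succ] at *
  omega

/-- The rotation shifts the numbers `A + 1, …, A + m` one to the right, and taking `A` to `p` shifts
them back home. Every `p ≥ e` works, which gives the multiplicity in the Stirling recursion. -/
theorem IsFrame.move_up {A m : ℕ} {σ : Equiv.Perm (Fin n)} (h : IsFrame A (m + 1) σ)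
    {a a' e p : Fin n} (ha : (a : ℕ) = A) (ha' : (a' : ℕ) = A + 1) (he : (e : ℕ) = A + m + 1)
    (hp : e ≤ p) : IsFrame (A + 1) m (σ * movePos a' e * movePos p a) := by
  have hen := e.2
  rw [Fin.le_def] at hp
  have key : ∀ j, (σ * movePos a' e * movePos p a).symm j =
    movePos a p (movePos e a' (σ.symm j)) := fun j => rfl
  refine ⟨fun j h₁ h₂ => ?_, fun j hj => ?_, fun j hj => ?_, fun j hj => ?_, ?_⟩
  · rw [key, h.inner j (by omega) (by omega), Fin.ext_iff]
    simp only [movePos_val]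
    split_ifs <;> omega
  · rw [key]
    rcases Nat.lt_succ_iff_lt_or_eq.1 hj with hj | hj
    · have := h.lower j hj
      simp only [movePos_val]
      split_ifs <;> omega
    · rw [h.inner j (by omega) (by omega)]
      simp only [movePos_val]
      split_ifs <;> omega
  · have := h.upper j (by omega)
    have := h.symm_outer j (by omega)
    rw [key]
    simp only [movePos_val]
    split_ifs <;> omega
  · have := h.next j (by omega)
    rw [key]
    simp only [movePos_val]
    split_ifs <;> omega
  · refine HomesIn.of_succ (by omega) rfl ((h.homes.rotate_up m (by omega) ?_).mul_movePos ?_ ?_)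
    · intro j h₁ h₂
      rw [Fin.le_def] at h₁
      rw [Fin.lt_def] at h₂
      exact h.apply_inner j (by omega) (by omega)
    · rw [Equiv.Perm.mul_apply]
      convert! h.apply_inner a (by omega) (by omega) using 2
      rw [Fin.ext_iff, movePos_val]
      split_ifs <;> omega
    · rw [ne_eq, Fin.ext_iff]
      omega

/-- The mirror move, with the greatest inner number `b` taken to position `A` only: a target just
before the block keeps `lower` for the other numbers, and `next` holds for `b`. -/
theorem IsFrame.move_down {A m : ℕ} {σ : Equiv.Perm (Fin n)} (h : IsFrame (A + 1) (m + 1) σ)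
    {a b b' : Fin n} (ha : (a : ℕ) = A) (hb : (b : ℕ) = A + m + 1) (hb' : (b' : ℕ) = A + m) :
    IsFrame (A + 1) m (σ * movePos b' a * movePos a b) := by
  have hbn := b.2
  have key : ∀ j, (σ * movePos b' a * movePos a b).symm j =
    movePos b a (movePos a b' (σ.symm j)) := fun j => rfl
  refine ⟨fun j h₁ h₂ => ?_, fun j hj => ?_, fun j hj => ?_, fun j hj => ?_, ?_⟩
  · rw [key, h.inner j (by omega) (by omega), Fin.ext_iff]
    simp only [movePos_val]
    split_ifs <;> omega
  · have := h.lower j hj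
    have := h.symm_outer j (by omega)
    rw [key]
    simp only [movePos_val]
    split_ifs <;> omega
  · rw [key]
    by_cases hjb : (j : ℕ) = b
    · rw [h.inner j (by omega) (by omega)]
      simp only [movePos_val]
      split_ifs <;> omega
    · have := h.upper j (by omega)
      simp only [movePos_val]
      split_ifs <;> omega
  · rw [key, h.inner j (by omega) (by omega)]
    simp only [movePos_val]
    split_ifs <;> omega
  · refine HomesIn.of_succ (by omega) rfl ((h.homes.rotate_down m (by omega) ?_).mul_movePos ?_ ?_)
    · intro j h₁ h₂
      rw [Fin.le_def] at h₂
      rw [Fin.lt_def] at h₁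
      exact h.apply_inner j (by omega) (by omega)
    · rw [Equiv.Perm.mul_apply]
      convert! h.apply_inner b (by omega) (by omega) using 2
      rw [Fin.ext_iff, movePos_val]
      split_ifs <;> omega
    · rw [ne_eq, Fin.ext_iff]
      omega

theorem exists_isFrame_one (hn : 2 ≤ n) : ∃ σ : Equiv.Perm (Fin n), IsFrame 1 (n - 2) σ := by
  obtain ⟨o, ho⟩ : ∃ o : Fin n, (o : ℕ) = 0 := ⟨⟨0, by omega⟩, rfl⟩
  obtain ⟨a, ha⟩ : ∃ a : Fin n, (a : ℕ) = 1 := ⟨⟨1, by omega⟩, rfl⟩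
  obtain ⟨e, he⟩ : ∃ e : Fin n, (e : ℕ) = n - 1 := ⟨⟨n - 1, by omega⟩, rfl⟩
  refine ⟨1 * movePos a e * movePos e o, ?_⟩
  have key : ∀ j, (1 * movePos a e * movePos e o).symm j = movePos o e (movePos e a j) :=
    fun j => rfl
  refine ⟨fun j h₁ h₂ => ?_, fun j hj => ?_, fun j hj => ?_, fun j hj => ?_, ?_⟩
  · rw [key, Fin.ext_iff]
    simp only [movePos_val]
    split_ifs <;> omega
  · rw [key]
    simp only [movePos_val]
    split_ifs <;> omega
  · have := j.2
    rw [key]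
    simp only [movePos_val]
    split_ifs <;> omega
  · rw [key]
    simp only [movePos_val]
    split_ifs <;> omega
  · convert! (HomesIn.refl.rotate_up (n - 2) (a := a) (e := e) (by omega) fun _ _ _ => rfl).mul_movePos
      (i := o) (q := e) ?_ ?_ using 1
    · obtain ⟨k, rfl⟩ := Nat.exists_eq_add_of_le' hn
      have := Nat.one_le_two_pow (n := k)
      simp only [Nat.add_sub_cancel, Nat.add_succ_sub_one, pow_succ]
      omega
    · rw [Equiv.Perm.mul_apply, Equiv.Perm.one_apply, Fin.ext_iff, movePos_val]
      split_ifs <;> omega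
    · rw [ne_eq, Fin.ext_iff]
      omega

/-- Here `C` is the number of large elements, and each step of `t` removes one inner number.
`move_up` contributes `C` images per frame and `move_down` one, matching `S(t + 2, C + 1) = (C + 1)
S(t + 1, C + 1) + S(t + 1, C)`. -/
theorem stirlingSecond_le_card_isFrame (t : ℕ) : ∀ A m C : ℕ, A + C = t + 2 → A + m + C = n →
    Nat.stirlingSecond (t + 1) C ≤ Nat.card {σ : Equiv.Perm (Fin n) // IsFrame A m σ} := by
  induction t with
  | zero =>
    intro A m C hAC hn
    rcases (by omega : C = 0 ∨ C = 1 ∨ C = 2) with rfl | rfl | rfl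
    · simp
    · obtain rfl : A = 1 := by omega
      obtain rfl : m = n - 2 := by omega
      obtain ⟨σ, hσ⟩ := exists_isFrame_one (n := n) (by omega)
      rw [Nat.stirlingSecond_self]
      have : Nonempty {σ : Equiv.Perm (Fin n) // IsFrame 1 (n - 2) σ} := ⟨⟨σ, hσ⟩⟩
      exact Nat.card_pos
    · rw [Nat.stirlingSecond_eq_zero_of_lt (by omega)]
      exact Nat.zero_le _
  | succ t ih =>
    intro A m C hAC hn
    rcases C with _ | C
    · simp
    rcases A with _ | A
    · rw [Nat.stirlingSecond_eq_zero_of_lt (by omega)]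
      exact Nat.zero_le _
    have h₁ := ih A (m + 1) (C + 1) (by omega) (by omega)
    have h₂ := ih (A + 1) (m + 1) C (by omega) (by omega)
    rw [Nat.stirlingSecond_succ_succ]
    obtain ⟨a, ha⟩ : ∃ a : Fin n, (a : ℕ) = A := ⟨⟨A, by omega⟩, rfl⟩
    obtain ⟨a', ha'⟩ : ∃ a : Fin n, (a : ℕ) = A + 1 := ⟨⟨A + 1, by omega⟩, rfl⟩
    obtain ⟨e, he⟩ : ∃ a : Fin n, (a : ℕ) = A + m + 1 := ⟨⟨A + m + 1, by omega⟩, rfl⟩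
    obtain ⟨b', hb'⟩ : ∃ a : Fin n, (a : ℕ) = A + m := ⟨⟨A + m, by omega⟩, rfl⟩
    obtain ⟨p, hpv⟩ : ∃ p : Fin (C + 1) → Fin n, ∀ c, (p c : ℕ) = A + m + 1 + c :=
      ⟨fun c => ⟨A + m + 1 + c, by omega⟩, fun _ => rfl⟩
    have hp : ∀ c, e ≤ p c := fun c => by
      rw [Fin.le_def, he, hpv]
      exact Nat.le_add_right _ _
    let f : (Fin (C + 1) × {σ : Equiv.Perm (Fin n) // IsFrame A (m + 1) σ}) ⊕
        {σ : Equiv.Perm (Fin n) // IsFrame (A + 1) (m + 1) σ} →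
        {σ : Equiv.Perm (Fin n) // IsFrame (A + 1) m σ} :=
      Sum.elim (fun x => ⟨_, x.2.2.move_up (a := a) (a' := a') (e := e) ha ha' he (hp x.1)⟩)
        (fun x => ⟨_, x.2.move_down (a := a) (b := e) (b' := b') ha he hb'⟩)
    have hup : ∀ x, (f (Sum.inl x)).1.symm a = p x.1 := by
      intro x
      change movePos a (p x.1) (movePos e a' (x.2.1.symm a)) = p x.1
      rw [x.2.2.inner a ha.ge (by omega), Fin.ext_iff]
      have := hp x.1
      rw [Fin.le_def] at this
      simp only [movePos_val]
      split_ifs <;> omega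
    -- By `next`, the number `e` stays left of position `a` after a `move_up`, whereas `move_down`
    -- puts it at `a`. Hence the two images are disjoint.
    have hup' : ∀ x, (f (Sum.inl x)).1.symm e ≠ a := by
      intro x
      change movePos a (p x.1) (movePos e a' (x.2.1.symm e)) ≠ a
      have := x.2.2.next e he
      have := hp x.1
      rw [Fin.le_def] at this
      rw [ne_eq, Fin.ext_iff]
      simp only [movePos_val]
      split_ifs <;> omega
    have hdown : ∀ x, (f (Sum.inr x)).1.symm e = a := by
      intro x
      change movePos e a (movePos a b' (x.1.symm e)) = a
      rw [x.2.inner e (by omega) (by omega), Fin.ext_iff]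
      simp only [movePos_val]
      split_ifs <;> omega
    have hf : Function.Injective f := by
      rintro (⟨c, σ⟩ | σ) (⟨c', σ'⟩ | σ') h
      · have hc := hup (c, σ)
        rw [h, hup (c', σ')] at hc
        obtain rfl : c' = c := by
          simp only [Fin.ext_iff, hpv] at hc
          exact Fin.ext (by omega)
        have h' : σ.1 * movePos a' e * movePos (p c') a = σ'.1 * movePos a' e * movePos (p c') a :=
          congrArg Subtype.val h
        rw [Subtype.ext (mul_right_cancel (mul_right_cancel h'))]
      · exact absurd (by rw [h, hdown]) (hup' (c, σ))
      · exact absurd (by rw [← h, hdown]) (hup' (c', σ'))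
      · have h' : σ.1 * movePos b' a * movePos a e = σ'.1 * movePos b' a * movePos a e :=
          congrArg Subtype.val h
        rw [Subtype.ext (mul_right_cancel (mul_right_cancel h'))]
    have := Nat.card_le_card_of_injective f hf
    rw [Nat.card_sum, Nat.card_prod, Nat.card_fin] at this
    exact le_trans (Nat.add_le_add (Nat.mul_le_mul_left _ h₁) h₂) this

/-- With an empty block, `A` is determined as the threshold between numbers right and left of their
homes, so frames for different `A` are distinct permutations. -/
theorem IsFrame.unique {A A' : ℕ} {σ : Equiv.Perm (Fin n)} (h : IsFrame A 0 σ)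
    (h' : IsFrame A' 0 σ) (hA : A ≤ n) (hA' : A' ≤ n) : A = A' := by
  by_contra hne
  rcases Nat.lt_or_gt_of_ne hne with hlt | hlt
  · have h₁ := h.upper ⟨A, by omega⟩ le_rfl
    have h₂ := h'.lower ⟨A, by omega⟩ hlt
    omega
  · have h₁ := h'.upper ⟨A', by omega⟩ le_rfl
    have h₂ := h.lower ⟨A', by omega⟩ hlt
    omega

theorem mem_worstCases (hn : 1 ≤ n) {σ : Equiv.Perm (Fin n)} (h : HomesIn σ (2 ^ (n - 1) - 1)) :
    σ ∈ worstCases n :=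
  ⟨h, fun _ hk => HomesIn.le hn hk⟩

theorem sum_stirlingSecond_le_ncard_worstCases (hn : 2 ≤ n) :
    ∑ C ∈ Finset.range n, Nat.stirlingSecond (n - 1) C ≤ (worstCases n).ncard := by
  classical
  calc ∑ C ∈ Finset.range n, Nat.stirlingSecond (n - 1) C
      ≤ ∑ C ∈ Finset.range n,
          (Finset.univ.filter fun σ : Equiv.Perm (Fin n) => IsFrame (n - C) 0 σ).card := by
        refine Finset.sum_le_sum fun C hC => ?_
        rw [Finset.mem_range] at hC
        have := stirlingSecond_le_card_isFrame (n := n) (n - 2) (n - C) 0 C (by omega) (by omega)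
        rw [Nat.card_eq_fintype_card, Fintype.card_subtype] at this
        rwa [show n - 1 = n - 2 + 1 by omega]
    _ = ((Finset.range n).biUnion fun C =>
          Finset.univ.filter fun σ : Equiv.Perm (Fin n) => IsFrame (n - C) 0 σ).card := by
        rw [Finset.card_biUnion]
        intro C hC C' hC' hne
        rw [Finset.mem_coe, Finset.mem_range] at hC hC'
        rw [Function.onFun, Finset.disjoint_left]
        intro σ hσ hσ'
        have := (Finset.mem_filter.1 hσ).2.unique (Finset.mem_filter.1 hσ').2 (by omega) (by omega)
        omega
    _ ≤ (worstCases n).ncard := by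
        rw [← Set.ncard_coe_finset]
        refine Set.ncard_le_ncard (fun σ hσ => ?_) (Set.toFinite _)
        simp only [Finset.coe_biUnion, Set.mem_iUnion, Finset.mem_coe, Finset.mem_filter] at hσ
        obtain ⟨C, -, -, h⟩ := hσ
        exact mem_worstCases (by omega) (by simpa using h.homes)

end

/-! ### Partitions, Stirling numbers and Bell numbers -/

theorem card_quotient_comap_castSucc {m : ℕ} (S : Setoid (Fin (m + 1))) :
    ((∃ i : Fin m, S (Fin.last m) i.castSucc) →
      Nat.card (Quotient (S.comap Fin.castSucc)) = Nat.card (Quotient S)) ∧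
    ((¬ ∃ i : Fin m, S (Fin.last m) i.castSucc) →
      Nat.card (Quotient (S.comap Fin.castSucc)) + 1 = Nat.card (Quotient S)) := by
  let g : Quotient (S.comap Fin.castSucc) → Quotient S :=
    Quotient.map' Fin.castSucc fun _ _ h => h
  have hg : Function.Injective g := by
    intro x y
    induction x using Quotient.inductionOn
    induction y using Quotient.inductionOn
    intro h
    exact Quotient.sound (Quotient.exact h :)
  constructor
  · rintro ⟨i, hi⟩
    refine Nat.card_congr (Equiv.ofBijective g ⟨hg, fun x => ?_⟩)
    induction x using Quotient.inductionOn with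
    | h x =>
    induction x using Fin.lastCases with
    | last => exact ⟨Quotient.mk _ i, Quotient.sound (S.symm hi)⟩
    | cast j => exact ⟨Quotient.mk _ j, rfl⟩
  · intro hne
    rw [← Finite.card_option]
    let g' : Option (Quotient (S.comap Fin.castSucc)) → Quotient S :=
      fun x => x.elim (Quotient.mk _ (Fin.last m)) g
    have hlast : ∀ x, g x ≠ Quotient.mk _ (Fin.last m) := by
      intro x h
      induction x using Quotient.inductionOn with
      | h x => exact hne ⟨x, S.symm (Quotient.exact h :)⟩
    refine Nat.card_congr (Equiv.ofBijective g' ⟨?_, fun x => ?_⟩)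
    · rintro (_ | x) (_ | y) h
      · rfl
      · exact absurd h.symm (hlast y)
      · exact absurd h (hlast x)
      · rw [hg h]
    · induction x using Quotient.inductionOn with
      | h x =>
      induction x using Fin.lastCases with
      | last => exact ⟨none, rfl⟩
      | cast j => exact ⟨some (Quotient.mk _ j), rfl⟩

instance finiteSetoid {α : Type*} [Finite α] : Finite (Setoid α) :=
  Finite.of_injective (fun S : Setoid α => S.r) fun S T h => by
    ext a b
    exact iff_of_eq (congrFun (congrFun h a) b)

theorem setoid_eq_of_comap_castSucc {m : ℕ} {S T : Setoid (Fin (m + 1))}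
    (h : S.comap Fin.castSucc = T.comap Fin.castSucc)
    (hl : ∀ i : Fin m, S (Fin.last m) i.castSucc ↔ T (Fin.last m) i.castSucc) : S = T := by
  ext a b
  induction a using Fin.lastCases with
  | last =>
    induction b using Fin.lastCases with
    | last => exact iff_of_true (S.refl _) (T.refl _)
    | cast j => exact hl j
  | cast i =>
    induction b using Fin.lastCases with
    | last => exact ⟨fun h => T.symm ((hl i).1 (S.symm h)), fun h => S.symm ((hl i).2 (T.symm h))⟩
    | cast j => exact Setoid.ext_iff.1 h i j

/-- The number of equivalence relations with `k` classes is at most a Stirling number. -/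
theorem card_setoid_le_stirlingSecond (m : ℕ) : ∀ k,
    Nat.card {S : Setoid (Fin m) // Nat.card (Quotient S) = k} ≤ Nat.stirlingSecond m k := by
  induction m with
  | zero =>
    intro k
    have h0 : ∀ S : Setoid (Fin 0), Nat.card (Quotient S) = 0 := fun S => by simp
    rcases k with _ | k
    · have : Subsingleton (Setoid (Fin 0)) := ⟨fun S T => Setoid.ext fun a => a.elim0⟩
      exact Finite.card_le_one_iff_subsingleton.2 inferInstance
    · have : IsEmpty {S : Setoid (Fin 0) // Nat.card (Quotient S) = k + 1} :=
        ⟨fun S => by have := S.2; rw [h0] at this; omega⟩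
      simp
  | succ m ih =>
    intro k
    rcases k with _ | k
    · have : IsEmpty {S : Setoid (Fin (m + 1)) // Nat.card (Quotient S) = 0} :=
        ⟨fun S => by
          have : Nonempty (Quotient S.1) := ⟨Quotient.mk _ 0⟩
          exact Nat.card_pos.ne' S.2⟩
      simp
    classical
    let e : ∀ S : {S : Setoid (Fin m) // Nat.card (Quotient S) = k + 1},
      Quotient S.1 ≃ Fin (k + 1) := fun S => Finite.equivFinOfCardEq S.2
    have he : ∀ (S T : {S : Setoid (Fin m) // Nat.card (Quotient S) = k + 1}) (i j : Fin m),
        S = T → e S (Quotient.mk _ i) = e T (Quotient.mk _ j) → S.1 i j := by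
      rintro S _ i j rfl h
      exact Quotient.exact ((e S).injective h)
    -- If the last element is not alone, `f` records its class in the restricted relation, numbered
    -- by `e`; otherwise the restriction alone determines `S`.
    let f : {S : Setoid (Fin (m + 1)) // Nat.card (Quotient S) = k + 1} →
        (Fin (k + 1) × {S : Setoid (Fin m) // Nat.card (Quotient S) = k + 1}) ⊕
          {S : Setoid (Fin m) // Nat.card (Quotient S) = k} := fun S =>
      if h : ∃ i : Fin m, S.1 (Fin.last m) i.castSucc then
        Sum.inl (e ⟨S.1.comap Fin.castSucc, ((card_quotient_comap_castSucc S.1).1 h).trans S.2⟩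
          (Quotient.mk _ h.choose),
          ⟨S.1.comap Fin.castSucc, ((card_quotient_comap_castSucc S.1).1 h).trans S.2⟩)
      else Sum.inr ⟨S.1.comap Fin.castSucc, Nat.succ_injective
        (((card_quotient_comap_castSucc S.1).2 h).trans S.2)⟩
    have hf : Function.Injective f := by
      rintro ⟨S, hS⟩ ⟨T, hT⟩ hST
      by_cases h₁ : ∃ i : Fin m, S (Fin.last m) i.castSucc <;>
        by_cases h₂ : ∃ i : Fin m, T (Fin.last m) i.castSucc
      · simp only [f, dif_pos h₁, dif_pos h₂, Sum.inl.injEq, Prod.mk.injEq] at hST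
        have hc := congrArg Subtype.val hST.2
        have hr : S h₁.choose.castSucc h₂.choose.castSucc := he _ _ _ _ hST.2 hST.1
        have hr' : T h₁.choose.castSucc h₂.choose.castSucc := (Setoid.ext_iff.1 hc _ _).1 hr
        refine Subtype.ext (setoid_eq_of_comap_castSucc hc fun i => ?_)
        have hi : S h₁.choose.castSucc i.castSucc ↔ T h₁.choose.castSucc i.castSucc :=
          Setoid.ext_iff.1 hc _ _
        have hs : S (Fin.last m) h₁.choose.castSucc := h₁.choose_spec
        have ht : T (Fin.last m) h₁.choose.castSucc := T.trans h₂.choose_spec (T.symm hr')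
        exact ⟨fun h => T.trans ht (hi.1 (S.trans (S.symm hs) h)),
          fun h => S.trans hs (hi.2 (T.trans (T.symm ht) h))⟩
      · simp [f, dif_pos h₁, dif_neg h₂] at hST
      · simp [f, dif_neg h₁, dif_pos h₂] at hST
      · simp only [f, dif_neg h₁, dif_neg h₂, Sum.inr.injEq] at hST
        refine Subtype.ext (setoid_eq_of_comap_castSucc (congrArg Subtype.val hST) fun i => ?_)
        exact iff_of_false (fun h => h₁ ⟨i, h⟩) (fun h => h₂ ⟨i, h⟩)
    have := Nat.card_le_card_of_injective f hf
    rw [Nat.card_sum, Nat.card_prod, Nat.card_fin] at this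
    rw [Nat.stirlingSecond_succ_succ]
    exact this.trans (Nat.add_le_add (Nat.mul_le_mul_left _ (ih _)) (ih _))

/-- The equivalence relation of lying in the same part of a partition. -/
def Finpartition.toSetoid {α : Type*} [Fintype α] [DecidableEq α]
    (P : Finpartition (Finset.univ : Finset α)) : Setoid α :=
  Setoid.ker P.part

theorem Finpartition.toSetoid_injective {α : Type*} [Fintype α] [DecidableEq α] :
    Function.Injective (Finpartition.toSetoid (α := α)) := by
  intro P Q h
  have hmem : ∀ a b, b ∈ P.part a ↔ b ∈ Q.part a := by
    intro a b
    rw [P.mem_part_iff_part_eq_part (Finset.mem_univ _) (Finset.mem_univ _),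
      Q.mem_part_iff_part_eq_part (Finset.mem_univ _) (Finset.mem_univ _)]
    exact Setoid.ext_iff.1 h b a
  have hpart : P.part = Q.part := funext fun a => Finset.ext fun b => hmem a b
  have parts : ∀ (R : Finpartition (Finset.univ : Finset α)) (p : Finset α),
      p ∈ R.parts ↔ ∃ a, R.part a = p := by
    intro R p
    constructor
    · intro hp
      obtain ⟨a, -, ha⟩ := R.part_surjOn hp
      exact ⟨a, ha⟩
    · rintro ⟨a, rfl⟩
      exact R.part_mem.2 (Finset.mem_univ a)
  refine Finpartition.ext (Finset.ext fun p => ?_)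
  rw [parts, parts, hpart]

theorem bellNumber_le_sum_stirlingSecond (m : ℕ) :
    bellNumber m ≤ ∑ k ∈ Finset.range (m + 1), Nat.stirlingSecond m k := by
  classical
  have := Fintype.ofFinite (Setoid (Fin m))
  have h₁ : bellNumber m ≤ Fintype.card (Setoid (Fin m)) :=
    Fintype.card_le_of_injective _ Finpartition.toSetoid_injective
  have h₂ : ∀ S ∈ (Finset.univ : Finset (Setoid (Fin m))),
      Nat.card (Quotient S) ∈ Finset.range (m + 1) := by
    intro S _
    rw [Finset.mem_range, Nat.lt_succ_iff]
    simpa using Nat.card_le_card_of_surjective (Quotient.mk S) Quotient.mk_surjective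
  rw [← Finset.card_univ, Finset.card_eq_sum_card_fiberwise h₂] at h₁
  refine h₁.trans (Finset.sum_le_sum fun k _ => ?_)
  have := card_setoid_le_stirlingSecond m k
  rwa [Nat.card_eq_fintype_card, Fintype.card_subtype] at this

/-! ### Growth and the main theorem -/

theorem pow_le_stirlingSecond (k j : ℕ) : k ^ j ≤ Nat.stirlingSecond (k + j) k := by
  induction j with
  | zero => simp [Nat.stirlingSecond_self]
  | succ j ih =>
    rcases k with _ | k
    · simp
    · rw [← add_assoc, Nat.stirlingSecond_succ_succ, pow_succ, mul_comm]
      exact (Nat.mul_le_mul_left _ ih).trans (Nat.le_add_right _ _)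

theorem bellNumber_le_ncard_worstCases {n : ℕ} (hn : 1 ≤ n) :
    bellNumber (n - 1) ≤ (worstCases n).ncard := by
  refine (bellNumber_le_sum_stirlingSecond (n - 1)).trans ?_
  rw [Nat.sub_add_cancel hn]
  -- Frames exist only from `n = 2` on; for `n = 1` the identity is the one worst case needed.
  rcases hn.eq_or_lt with rfl | hn
  · have : (1 : Equiv.Perm (Fin 1)) ∈ worstCases 1 := mem_worstCases le_rfl .refl
    have hpos := (Set.ncard_pos (Set.toFinite _)).2 ⟨_, this⟩
    simpa using Nat.succ_le_of_lt hpos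
  · exact sum_stirlingSecond_le_ncard_worstCases hn

theorem tendsto_ncard_worstCases_div_pow {C : ℝ} (hC : 0 < C) :
    Filter.Tendsto (fun n : ℕ => ((worstCases n).ncard : ℝ) / C ^ n) Filter.atTop
      Filter.atTop := by
  -- With `k ≥ 2 * C` fixed, `k ^ (n - 1 - k)` worst cases already exceed `C ^ n` by a factor `2 ^ n
  -- / k ^ (k + 1)`.
  obtain ⟨k, hk⟩ := exists_nat_ge (2 * C)
  have hk0 : (0 : ℝ) < k := by linarith
  have key : ∀ᶠ n : ℕ in Filter.atTop,
      (2 : ℝ) ^ n / (k : ℝ) ^ (k + 1) ≤ ((worstCases n).ncard : ℝ) / C ^ n := by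
    filter_upwards [Filter.eventually_ge_atTop (k + 2)] with n hn
    obtain ⟨j, rfl⟩ := Nat.exists_eq_add_of_le hn
    have h₁ : k ^ (j + 1) ≤ (worstCases (k + 2 + j)).ncard := by
      refine le_trans ?_ (sum_stirlingSecond_le_ncard_worstCases (by omega))
      refine (pow_le_stirlingSecond k (j + 1)).trans ?_
      rw [show k + 2 + j - 1 = k + (j + 1) by omega]
      exact Finset.single_le_sum (f := fun C => Nat.stirlingSecond (k + (j + 1)) C)
        (fun _ _ => Nat.zero_le _) (Finset.mem_range.2 (by omega))
    have h₂ : (k : ℝ) ^ (j + 1) ≤ (worstCases (k + 2 + j)).ncard := by exact_mod_cast h₁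
    rw [div_le_div_iff₀ (by positivity) (by positivity), ← mul_pow]
    calc (2 * C) ^ (k + 2 + j) ≤ (k : ℝ) ^ (k + 2 + j) :=
          pow_le_pow_left₀ (by positivity) hk _
      _ = (k : ℝ) ^ (j + 1) * (k : ℝ) ^ (k + 1) := by rw [← pow_add]; congr 1; omega
      _ ≤ _ := by gcongr
  refine Filter.tendsto_atTop_mono' _ key (Filter.Tendsto.atTop_div_const (by positivity) ?_)
  exact tendsto_pow_atTop_atTop_of_one_lt (by norm_num)

theorem theorem6p6 :
    (∀ n : ℕ, 1 ≤ n →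
      IsGreatest {k : ℕ | ∃ π : Equiv.Perm (Fin n), HomesIn π k} (2 ^ (n - 1) - 1) ∧
      bellNumber (n - 1) ≤ (worstCases n).ncard) ∧
    (∀ C : ℝ, 0 < C →
      Filter.Tendsto (fun n : ℕ => ((worstCases n).ncard : ℝ) / C ^ n)
        Filter.atTop Filter.atTop) := by
  refine ⟨fun n hn => ?_, fun C hC => tendsto_ncard_worstCases_div_pow hC⟩
  have hbell := bellNumber_le_ncard_worstCases hn
  refine ⟨⟨?_, fun k ⟨_, h⟩ => h.le hn⟩, hbell⟩
  -- The maximum is attained because the Bell number is positive and so `worstCases n` is nonempty.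
  have hpos : 0 < bellNumber (n - 1) := Fintype.card_pos_iff.2 ⟨⊥⟩
  obtain ⟨π, hπ⟩ := (Set.ncard_pos (Set.toFinite _)).1 (hpos.trans_le hbell)
  exact ⟨π, hπ.1⟩
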